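/- For a finite simple graph $G$ and an integer $k\ge 0$, let $\gamma_k(G)$ be the number of dominating sets of $G$ of size $k$, where a set $D$ of vertices is dominating if every vertex of $G$ is in $D$ or adjacent to some vertex of $D$. For an integer $\ell\ge 1$, the $\ell$-th power of $G$ is the graph on the same vertex set in which two distinct vertices are adjacent if and only if their distance in $G$ is at most $\ell$. Let $P_n^\ell$ and $C_n^\ell$ be the $\ell$-th powers of the path and of the cycle on $n$ vertices; here the path and the cycle on $0$ vertices are the graph with no vertices, the cycle on $1$ vertex is a single isolated vertex, and the cycle on $2$ vertices is the complete graph on two vertices. Theorem. For every $n\ge 0$ and $\ell\ge 1$, the domination sequences $(\gamma_k(P_n^\ell))_{k\ge 0}$ and $(\gamma_k(C_n^\ell))_{k\ge 0}$ are unimodal; that is, for each of them, writing it as $(a_k)_{k\ge 0}$, there is an index $m\ge 0$ with $a_0\le a_1\le\cdots\le a_m\ge a_{m+1}\ge a_{m+2}\ge\cdots$. -/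

import Mathlib

/-- The `ℓ`-th power of a graph: same vertices, two distinct vertices being adjacent when their
distance is at most `ℓ`. The extended distance is used, so that vertices in different components
are at distance `⊤`. -/
def SimpleGraph.power {V : Type*} (G : SimpleGraph V) (ℓ : ℕ) : SimpleGraph V where
  Adj u v := u ≠ v ∧ G.edist u v ≤ (ℓ : ℕ∞)
  symm := ⟨fun _ _ h => ⟨h.1.symm, by rw [SimpleGraph.edist_comm]; exact h.2⟩⟩
  loopless := ⟨fun _ h => h.1 rfl⟩

/-- `D` is a dominating set: every vertex is in `D` or adjacent to some vertex of `D`. -/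
def SimpleGraph.IsDominatingSet {V : Type*} (G : SimpleGraph V) (D : Finset V) : Prop :=
  ∀ v : V, v ∈ D ∨ ∃ u ∈ D, G.Adj v u

open Classical in
/-- The number of dominating sets of size `k`; as a function of `k : ℕ`, this is the domination
sequence of `G`. -/
noncomputable def SimpleGraph.dominationSeq {V : Type*} [Fintype V] (G : SimpleGraph V) (k : ℕ) :
    ℕ :=
  ((Finset.univ : Finset (Finset V)).filter fun D => D.card = k ∧ G.IsDominatingSet D).card

/-- A sequence is unimodal if it is weakly increasing up to some index `m` and weakly decreasing
from `m` on. -/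
def IsUnimodal (a : ℕ → ℕ) : Prop :=
  ∃ m : ℕ, (∀ k, k < m → a k ≤ a (k + 1)) ∧ (∀ k, m ≤ k → a (k + 1) ≤ a k)

/-! A nonempty dominating set with minimum `f` and maximum `s` in `{0, …, m}` is recognised by its
gaps: consecutive elements differ by at most `2ℓ + 1`, with a condition on the `f` points before and
the `m - s` points after. For the path each end is at most `ℓ`; for the cycle, cut at `0`, their sum
is at most `2ℓ`. Hence the number of dominating sets of size `k + 1` is the coefficient of `X ^ m`
in `g * p ^ k`, where `p = X + ⋯ + X ^ (2ℓ + 1)` and `g` counts the admissible ends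
(`dominationSeq_succ_eq_coeff`).

For fixed `m` this is log-concave in `k`. Multiplication by a log-concave series preserves the
likelihood-ratio order, by Cauchy–Binet (`RatioLE.mul_right`), so `g * p ^ i` precedes `g * p ^ j`
for `i ≤ j`. Comparing convolutions with `p` term by term (`RatioLE.coeff_mul_le`) yields the
inequality between exponents `i`, `i + 1`, `j`, `j + 1`. -/

open Finset

/-! ### Likelihood-ratio order and log-concave series -/

namespace PowerSeries

/-- Likelihood-ratio order on coefficient sequences: `coeff n G / coeff n F` increases with `n`. -/
def RatioLE (F G : PowerSeries ℕ) : Prop :=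
  ∀ x y, x ≤ y → coeff y F * coeff x G ≤ coeff x F * coeff y G

/-- The coefficient sequence is log-concave without internal zeros. -/
def IsLogConcave (f : PowerSeries ℕ) : Prop :=
  ∀ a d e, coeff a f * coeff (a + d + e) f ≤ coeff (a + d) f * coeff (a + e) f

theorem ratioLE_one_left (G : PowerSeries ℕ) : RatioLE 1 G := by
  intro x y h
  rcases Nat.eq_zero_or_pos y with rfl | hy
  · obtain rfl : x = 0 := by omega
    exact le_rfl
  · simp [coeff_one, hy.ne']

theorem coeff_mul_eq_sum_range (F f : PowerSeries ℕ) {x y : ℕ} (h : x ≤ y) :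
    coeff x (F * f) = ∑ u ∈ range (y + 1), coeff u F * (if u ≤ x then coeff (x - u) f else 0) := by
  rw [coeff_mul, Finset.Nat.sum_antidiagonal_eq_sum_range_succ_mk]
  have hsub : range (x + 1) ⊆ range (y + 1) := range_subset_range.2 (by omega)
  rw [← sum_subset hsub]
  · refine sum_congr rfl fun u hu => ?_
    rw [if_pos (by simpa [Nat.lt_succ_iff] using hu)]
  · intro u _ hu
    rw [if_neg (by simpa [Nat.lt_succ_iff] using hu), mul_zero]

/-- If `v ≤ x`, this is log-concavity with base `x - v` and shifts `v - u`, `y - x`; otherwise the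
left side vanishes. -/
theorem IsLogConcave.toeplitz_minor {f : PowerSeries ℕ} (hf : f.IsLogConcave) {u v x y : ℕ}
    (huv : u ≤ v) (hxy : x ≤ y) :
    (if u ≤ y then coeff (y - u) f else 0) * (if v ≤ x then coeff (x - v) f else 0) ≤
      (if u ≤ x then coeff (x - u) f else 0) * (if v ≤ y then coeff (y - v) f else 0) := by
  by_cases h : v ≤ x
  · rw [if_pos (by omega), if_pos h, if_pos (by omega), if_pos (by omega), mul_comm]
    have := hf (x - v) (v - u) (y - x)
    rwa [show x - v + (v - u) + (y - x) = y - u by omega, show x - v + (v - u) = x - u by omega,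
      show x - v + (y - x) = y - v by omega] at this
  · simp [h]

/-- The `2 × 2` Cauchy–Binet inequality. -/
theorem sum_mul_sum_le_of_minors (a b s t : ℕ → ℕ) (S : Finset ℕ)
    (hab : ∀ u v, u ≤ v → a v * b u ≤ a u * b v) (hst : ∀ u v, u ≤ v → t u * s v ≤ s u * t v) :
    (∑ u ∈ S, a u * t u) * (∑ v ∈ S, b v * s v) ≤
      (∑ u ∈ S, a u * s u) * (∑ v ∈ S, b v * t v) := by
  zify
  have key : ∀ u v, u ≤ v →
      0 ≤ ((a u : ℤ) * b v - a v * b u) * ((s u : ℤ) * t v - t u * s v) := fun u v huv =>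
    mul_nonneg (sub_nonneg.2 (by exact_mod_cast hab u v huv))
      (sub_nonneg.2 (by exact_mod_cast hst u v huv))
  -- The summand is symmetric in `u` and `v`, so `u ≤ v` may be assumed; the double sum is twice the
  -- difference of the two sides.
  have nonneg : 0 ≤ ∑ u ∈ S, ∑ v ∈ S,
      ((a u : ℤ) * b v - a v * b u) * ((s u : ℤ) * t v - t u * s v) := by
    refine sum_nonneg fun u _ => sum_nonneg fun v _ => ?_
    rcases le_total u v with huv | huv
    · exact key u v huv
    · have := key v u huv
      linarith
  have expand : ∑ u ∈ S, ∑ v ∈ S,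
      ((a u : ℤ) * b v - a v * b u) * ((s u : ℤ) * t v - t u * s v) =
      2 * ((∑ u ∈ S, (a u : ℤ) * s u) * (∑ v ∈ S, (b v : ℤ) * t v)) -
      2 * ((∑ u ∈ S, (a u : ℤ) * t u) * (∑ v ∈ S, (b v : ℤ) * s v)) := by
    have e1 : ∑ u ∈ S, ∑ v ∈ S,
        ((a u : ℤ) * b v - a v * b u) * ((s u : ℤ) * t v - t u * s v) =
        ∑ u ∈ S, ∑ v ∈ S, (((a u : ℤ) * s u) * (b v * t v) +
          ((b u : ℤ) * t u) * (a v * s v) - ((a u : ℤ) * t u) * (b v * s v) -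
          ((b u : ℤ) * s u) * (a v * t v)) :=
      sum_congr rfl fun u _ => sum_congr rfl fun v _ => by ring
    rw [e1]
    simp only [sum_sub_distrib, sum_add_distrib, ← sum_mul_sum]
    ring
  linarith

theorem RatioLE.mul_right {F G f : PowerSeries ℕ} (h : RatioLE F G) (hf : f.IsLogConcave) :
    RatioLE (F * f) (G * f) := by
  intro x y hxy
  rw [coeff_mul_eq_sum_range F f le_rfl, coeff_mul_eq_sum_range G f hxy,
    coeff_mul_eq_sum_range F f hxy, coeff_mul_eq_sum_range G f le_rfl]
  exact sum_mul_sum_le_of_minors (fun u => coeff u F) (fun u => coeff u G)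
    (fun u => if u ≤ x then coeff (x - u) f else 0) (fun u => if u ≤ y then coeff (y - u) f else 0)
    _ h fun u v huv => hf.toeplitz_minor huv hxy

theorem RatioLE.mul_pow_right {F G f : PowerSeries ℕ} (h : RatioLE F G) (hf : f.IsLogConcave)
    (k : ℕ) : RatioLE (F * f ^ k) (G * f ^ k) := by
  induction k with
  | zero => simpa using h
  | succ k ih => simpa only [pow_succ, mul_assoc] using ih.mul_right hf

/-- Each term of the convolution with `p` involves an index at most `n`, which the ratio order
compares with `n`. -/
theorem RatioLE.coeff_mul_le {F G : PowerSeries ℕ} (h : RatioLE F G) (p : PowerSeries ℕ) (n : ℕ) :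
    coeff n F * coeff n (p * G) ≤ coeff n (p * F) * coeff n G := by
  rw [coeff_mul, coeff_mul, mul_sum, sum_mul]
  refine sum_le_sum fun ij hij => ?_
  have := h ij.2 n (by have := HasAntidiagonal.mem_antidiagonal.1 hij; omega)
  calc _ = coeff ij.1 p * (coeff n F * coeff ij.2 G) := by ring
    _ ≤ coeff ij.1 p * (coeff ij.2 F * coeff n G) := Nat.mul_le_mul_left _ this
    _ = _ := by ring

/-- For fixed `n`, the sequence `k ↦ [xⁿ] g pᵏ` is strongly log-concave. -/
theorem coeff_mul_pow_logConcave {p g : PowerSeries ℕ}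
    (hg : ∀ j, RatioLE g (g * p ^ j)) (hp : p.IsLogConcave) (n : ℕ) {i j : ℕ} (hij : i ≤ j) :
    coeff n (g * p ^ i) * coeff n (g * p ^ (j + 1)) ≤
      coeff n (g * p ^ (i + 1)) * coeff n (g * p ^ j) := by
  have h : RatioLE (g * p ^ i) (g * p ^ j) := by
    have := (hg (j - i)).mul_pow_right hp i
    rwa [mul_assoc, ← pow_add, Nat.sub_add_cancel hij] at this
  have := h.coeff_mul_le p n
  rwa [show p * (g * p ^ j) = g * p ^ (j + 1) by ring,
    show p * (g * p ^ i) = g * p ^ (i + 1) by ring] at this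

theorem IsLogConcave.ratioLE_mul {g : PowerSeries ℕ} (hg : g.IsLogConcave) (F : PowerSeries ℕ) :
    RatioLE g (g * F) := by
  simpa [mul_comm] using (ratioLE_one_left F).mul_right hg

end PowerSeries

/-! ### Unimodality from log-concavity -/

theorem isUnimodal_of_logConcave {a : ℕ → ℕ} {N : ℕ} (hN : ∀ k, N < k → a k = 0)
    (h : ∀ i j, i < j → a i * a (j + 1) ≤ a (i + 1) * a j) : IsUnimodal a := by
  classical
  by_cases hex : ∃ m, a (m + 1) < a m
  · refine ⟨Nat.find hex, fun k hk => not_lt.1 (Nat.find_min hex hk), fun k hk => ?_⟩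
    have hm := Nat.find_spec hex
    rcases hk.eq_or_lt with rfl | hk
    · exact hm.le
    -- At the first descent `m`, `a m` is positive and can be cancelled, so internal zeros do no
    -- harm.
    · exact Nat.le_of_mul_le_mul_left ((h _ k hk).trans (Nat.mul_le_mul_right _ hm.le)) (by omega)
  · push Not at hex
    exact ⟨N + 1, fun k _ => hex k, fun k hk => by simp [hN (k + 1) (by omega)]⟩

theorem isUnimodal_of_coeff {a : ℕ → ℕ} {N n : ℕ} {p g : PowerSeries ℕ}
    (hN : ∀ k, N < k → a k = 0) (h0 : a 0 = 0)
    (ha : ∀ k, a (k + 1) = PowerSeries.coeff n (g * p ^ k))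
    (hg : ∀ j, PowerSeries.RatioLE g (g * p ^ j)) (hp : p.IsLogConcave) : IsUnimodal a := by
  refine isUnimodal_of_logConcave hN fun i j hij => ?_
  rcases i with _ | i
  · simp [h0]
  · obtain ⟨j, rfl⟩ : ∃ j', j = j' + 1 := ⟨j - 1, by omega⟩
    simp only [ha]
    exact PowerSeries.coeff_mul_pow_logConcave hg hp n (by omega)

/-! ### Balls in paths and cycles -/

namespace SimpleGraph

theorem le_length_of_step {V : Type*} {G : SimpleGraph V} (d : V → V → ℕ)
    (h0 : ∀ u w, d u w = 0 ↔ u = w) (hle : ∀ u v w, G.Adj u v → d u w ≤ d v w + 1) {u w : V}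
    (p : G.Walk u w) : d u w ≤ p.length := by
  induction p with
  | nil => simp [(h0 _ _).2 rfl]
  | cons hadj q ih => simpa using (hle _ _ _ hadj).trans (Nat.succ_le_succ ih)

/-- Characterisation of balls for a function that changes by at most one along edges and can
always be decreased by a step. -/
theorem edist_le_iff_of_step {V : Type*} {G : SimpleGraph V} (d : V → V → ℕ)
    (h0 : ∀ u w, d u w = 0 ↔ u = w) (hle : ∀ u v w, G.Adj u v → d u w ≤ d v w + 1)
    (hstep : ∀ u w, d u w ≠ 0 → ∃ v, G.Adj u v ∧ d v w < d u w) (u w : V) (ℓ : ℕ) :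
    G.edist u w ≤ (ℓ : ℕ∞) ↔ d u w ≤ ℓ := by
  constructor
  · intro h
    have hne : G.edist u w ≠ ⊤ := ne_top_of_le_ne_top (ENat.natCast_ne_top ℓ) h
    obtain ⟨p, hp⟩ := G.exists_walk_of_edist_ne_top hne
    rw [← hp] at h
    exact (le_length_of_step d h0 hle p).trans (by exact_mod_cast h)
  · have hwalk : ∀ t u, d u w ≤ t → ∃ p : G.Walk u w, p.length ≤ t := by
      intro t
      induction t with
      | zero =>
        intro u hu
        obtain rfl := (h0 u w).1 (by omega)
        exact ⟨.nil, le_rfl⟩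
      | succ t ih =>
        intro u hu
        by_cases hz : d u w = 0
        · obtain rfl := (h0 u w).1 hz
          exact ⟨.nil, by simp⟩
        · obtain ⟨v, hv, hlt⟩ := hstep u w hz
          obtain ⟨p, hp⟩ := ih v (by omega)
          exact ⟨.cons hv p, by simpa using hp⟩
    intro h
    obtain ⟨p, hp⟩ := hwalk ℓ u h
    exact (G.edist_le p).trans (by exact_mod_cast hp)

theorem edist_pathGraph_le_iff {n : ℕ} (u w : Fin n) (ℓ : ℕ) :
    (pathGraph n).edist u w ≤ (ℓ : ℕ∞) ↔ (u : ℕ) ≤ w + ℓ ∧ (w : ℕ) ≤ u + ℓ := by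
  rw [edist_le_iff_of_step (fun u w : Fin n => (u - w : ℕ) + (w - u : ℕ))]
  · omega
  · intro u w; rw [Fin.ext_iff]; omega
  · intro u v w h
    rw [pathGraph_adj] at h
    omega
  · intro u w h
    rcases lt_or_ge (u : ℕ) w with huw | huw
    · exact ⟨⟨u + 1, by omega⟩, by rw [pathGraph_adj]; simp, by dsimp only; omega⟩
    · exact ⟨⟨u - 1, by omega⟩, by rw [pathGraph_adj]; dsimp only; omega, by dsimp only; omega⟩

theorem cycleGraph_adj_iff_val {m : ℕ} (u v : Fin (m + 1)) :
    (cycleGraph (m + 1)).Adj u v ↔ (u : ℕ) + 1 = v ∨ (v : ℕ) + 1 = u ∨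
      ((u : ℕ) = 0 ∧ (v : ℕ) = m ∧ 0 < m) ∨ ((v : ℕ) = 0 ∧ (u : ℕ) = m ∧ 0 < m) := by
  rw [cycleGraph_adj']
  have h : ∀ u v : Fin (m + 1), ((u - v : Fin (m + 1)) : ℕ) = 1 ↔
      (v : ℕ) + 1 = u ∨ ((u : ℕ) = 0 ∧ (v : ℕ) = m ∧ 0 < m) := by
    intro u v
    rcases le_or_gt v u with hvu | hvu
    · rw [Fin.coe_sub_iff_le.2 hvu]
      have : (v : ℕ) ≤ u := hvu
      omega
    · rw [Fin.coe_sub_iff_lt.2 hvu]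
      have : (u : ℕ) < v := hvu
      omega
  rw [h, h]
  omega

theorem edist_cycleGraph_le_iff {m : ℕ} (u w : Fin (m + 1)) (ℓ : ℕ) :
    (cycleGraph (m + 1)).edist u w ≤ (ℓ : ℕ∞) ↔
      ((u : ℕ) ≤ w + ℓ ∧ (w : ℕ) ≤ u + ℓ) ∨ (u : ℕ) + (m + 1) ≤ w + ℓ ∨
        (w : ℕ) + (m + 1) ≤ u + ℓ := by
  -- One truncated difference is always zero, so their sum is `|u - w|`; the minimum picks the
  -- shorter arc.
  rw [edist_le_iff_of_step (fun u w : Fin (m + 1) =>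
    min ((u - w : ℕ) + (w - u : ℕ)) (m + 1 - ((u - w : ℕ) + (w - u : ℕ))))]
  · omega
  · intro u w; rw [Fin.ext_iff]; omega
  · intro u v w h
    rw [cycleGraph_adj_iff_val] at h
    omega
  · intro u w h
    have up : ∀ hu : (u : ℕ) < m, (cycleGraph (m + 1)).Adj u ⟨u + 1, by omega⟩ := by
      intro hu; rw [cycleGraph_adj_iff_val]; dsimp only; omega
    have down : (u : ℕ) ≠ 0 → (cycleGraph (m + 1)).Adj u ⟨u - 1, by omega⟩ := by
      intro hu; rw [cycleGraph_adj_iff_val]; dsimp only; omega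
    have last : (u : ℕ) = 0 → 0 < m → (cycleGraph (m + 1)).Adj u ⟨m, by omega⟩ := by
      intro hu hm; rw [cycleGraph_adj_iff_val]; dsimp only; omega
    have first : (u : ℕ) = m → 0 < m → (cycleGraph (m + 1)).Adj u ⟨0, by omega⟩ := by
      intro hu hm; rw [cycleGraph_adj_iff_val]; dsimp only; omega
    -- The increasing direction, possibly wrapping past `m`, gives a shortest arc from `u` to `w`.
    by_cases hup : ((u : ℕ) < w ∧ (w - u : ℕ) ≤ m + 1 - (w - u)) ∨
        ((w : ℕ) < u ∧ m + 1 - (u - w : ℕ) ≤ (u - w : ℕ))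
    · by_cases hum : (u : ℕ) < m
      · exact ⟨_, up hum, by dsimp only; omega⟩
      · exact ⟨_, first (by omega) (by omega), by dsimp only; omega⟩
    · by_cases hu0 : (u : ℕ) = 0
      · exact ⟨_, last hu0 (by omega), by dsimp only; omega⟩
      · exact ⟨_, down hu0, by dsimp only; omega⟩

end SimpleGraph

/-! ### The series for gaps and ends -/

namespace PowerSeries

/-- `X + X² + ⋯ + Xʷ`. -/
noncomputable def gapSeries (w : ℕ) : PowerSeries ℕ := mk fun j => if 1 ≤ j ∧ j ≤ w then 1 else 0

theorem isLogConcave_gapSeries (w : ℕ) : (gapSeries w).IsLogConcave := by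
  intro a d e
  simp only [gapSeries, coeff_mk]
  by_cases h : (1 ≤ a ∧ a ≤ w) ∧ (1 ≤ a + d + e ∧ a + d + e ≤ w)
  · rw [if_pos (by omega), if_pos (by omega), if_pos (by omega), if_pos (by omega)]
  · rcases not_and_or.1 h with h | h <;> simp [h]

theorem isLogConcave_indicator (ℓ : ℕ) :
    (mk fun j => if j ≤ ℓ then 1 else 0 : PowerSeries ℕ).IsLogConcave := by
  intro a d e
  simp only [coeff_mk]
  by_cases h : a + d + e ≤ ℓ
  · rw [if_pos (by omega), if_pos (by omega), if_pos (by omega), if_pos (by omega)]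
  · simp [h]

theorem isLogConcave_ramp (w : ℕ) :
    (mk fun j => if j ≤ w then j + 1 else 0 : PowerSeries ℕ).IsLogConcave := by
  intro a d e
  simp only [coeff_mk]
  by_cases h : a + d + e ≤ w
  · rw [if_pos (by omega), if_pos (by omega), if_pos (by omega), if_pos (by omega)]
    -- The difference of the two sides is exactly `d * e`.
    nlinarith [Nat.zero_le (d * e)]
  · simp [h]

end PowerSeries

/-! ### Counting sets with bounded gaps -/

/-- Sets of `k + 1` integers with minimum `f` and maximum `f + d` all of whose gaps are at most
`w`. -/
def gapSets (w f k d : ℕ) : Finset (Finset ℕ) :=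
  (Icc f (f + d)).powerset.filter fun D => f ∈ D ∧ f + d ∈ D ∧ D.card = k + 1 ∧
    ∀ x ∈ Ico f (f + d), ∃ y ∈ D, x < y ∧ y ≤ x + w

theorem mem_gapSets {w f k d : ℕ} {D : Finset ℕ} :
    D ∈ gapSets w f k d ↔ (∀ x ∈ D, f ≤ x ∧ x ≤ f + d) ∧ f ∈ D ∧ f + d ∈ D ∧ D.card = k + 1 ∧
      ∀ x, f ≤ x → x < f + d → ∃ y ∈ D, x < y ∧ y ≤ x + w := by
  simp only [gapSets, mem_filter, mem_powerset, subset_iff, mem_Icc, mem_Ico, and_imp]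

theorem card_gapSets_zero (w f d : ℕ) : (gapSets w f 0 d).card = if d = 0 then 1 else 0 := by
  split_ifs with h
  · subst h
    rw [card_eq_one]
    refine ⟨{f}, ext fun D => ?_⟩
    rw [mem_gapSets, mem_singleton]
    constructor
    · rintro ⟨-, hf, -, hc, -⟩
      obtain ⟨a, rfl⟩ := card_eq_one.1 hc
      rw [mem_singleton.1 hf]
    · rintro rfl
      exact ⟨by simp, by simp, by simp, by simp, fun x h1 h2 => by omega⟩
  · rw [card_eq_zero, eq_empty_iff_forall_notMem]
    intro D hD
    obtain ⟨-, hf, hs, hc, -⟩ := mem_gapSets.1 hD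
    have := card_le_one.1 hc.le _ hf _ hs
    omega

theorem insert_mem_gapSets {w f k a b : ℕ} (hb : 1 ≤ b ∧ b ≤ w) {D : Finset ℕ}
    (hD : D ∈ gapSets w f k a) : insert (f + (a + b)) D ∈ gapSets w f (k + 1) (a + b) := by
  obtain ⟨hbd, hf, hs, hc, hg⟩ := mem_gapSets.1 hD
  refine mem_gapSets.2 ⟨?_, mem_insert_of_mem hf, mem_insert_self _ _, ?_, ?_⟩
  · intro x hx
    rcases mem_insert.1 hx with rfl | hx
    · omega
    · have := hbd x hx
      omega
  · rw [card_insert_of_notMem, hc]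
    intro hmem
    have := hbd _ hmem
    omega
  · intro x h1 h2
    by_cases hx : x < f + a
    · obtain ⟨y, hy, h⟩ := hg x h1 hx
      exact ⟨y, mem_insert_of_mem hy, h⟩
    · exact ⟨_, mem_insert_self _ _, by omega, by omega⟩

theorem exists_erase_mem_gapSets {w f k d : ℕ} {D : Finset ℕ} (hD : D ∈ gapSets w f (k + 1) d) :
    ∃ a b, a + b = d ∧ (1 ≤ b ∧ b ≤ w) ∧ D.erase (f + d) ∈ gapSets w f k a := by
  obtain ⟨hbd, hf, hs, hc, hg⟩ := mem_gapSets.1 hD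
  have hc' : (D.erase (f + d)).card = k + 1 := by rw [card_erase_of_mem hs, hc]; rfl
  have hne : (D.erase (f + d)).Nonempty := card_pos.1 (by omega)
  set s := (D.erase (f + d)).max' hne with hs'
  have hsm : s ∈ D.erase (f + d) := max'_mem _ _
  have hsd : s ≠ f + d := ne_of_mem_erase hsm
  have hsb := hbd s (mem_of_mem_erase hsm)
  have hle : ∀ x ∈ D.erase (f + d), x ≤ s := fun x hx => le_max' _ x hx
  -- Only the maximum lies above the second largest element `s`, so the gap condition at `s` bounds
  -- the last gap by `w`.
  obtain ⟨y, hy, hy1, hy2⟩ := hg s hsb.1 (by omega)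
  have hyd : y = f + d := by
    by_contra hyd
    have := hle y (mem_erase.2 ⟨hyd, hy⟩)
    omega
  refine ⟨s - f, f + d - s, by omega, by omega, mem_gapSets.2 ⟨?_, ?_, ?_, hc', ?_⟩⟩
  · intro x hx
    have := hbd x (mem_of_mem_erase hx)
    have := hle x hx
    omega
  · exact mem_erase.2 ⟨by omega, hf⟩
  · rwa [show f + (s - f) = s by omega]
  · intro x h1 h2
    obtain ⟨z, hz, hz1, hz2⟩ := hg x h1 (by omega)
    by_cases hzd : z = f + d
    · exact ⟨s, hsm, by omega, by omega⟩
    · exact ⟨z, mem_erase.2 ⟨hzd, hz⟩, hz1, hz2⟩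

/-- Removing the maximum is a bijection onto pairs of a smaller set and a last gap, so adding an
element convolves with the gap series. -/
theorem card_gapSets_succ (w f k d : ℕ) :
    (gapSets w f (k + 1) d).card =
      ∑ ab ∈ antidiagonal d, (gapSets w f k ab.1).card * (if 1 ≤ ab.2 ∧ ab.2 ≤ w then 1 else 0) := by
  have hS : gapSets w f (k + 1) d = ((antidiagonal d).filter fun ab => 1 ≤ ab.2 ∧ ab.2 ≤ w).biUnion
      fun ab => (gapSets w f k ab.1).image (insert (f + d)) := by
    ext D
    simp only [mem_biUnion, mem_filter, HasAntidiagonal.mem_antidiagonal, mem_image]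
    constructor
    · intro hD
      obtain ⟨a, b, hab, hb, hE⟩ := exists_erase_mem_gapSets hD
      exact ⟨(a, b), ⟨hab, hb⟩, _, hE, insert_erase (mem_gapSets.1 hD).2.2.1⟩
    · rintro ⟨⟨a, b⟩, ⟨rfl, hb⟩, E, hE, rfl⟩
      exact insert_mem_gapSets hb hE
  have herase : ∀ {a b : ℕ}, a + b = d → 1 ≤ b → ∀ {E}, E ∈ gapSets w f k a →
      (insert (f + d) E).erase (f + d) = E := by
    intro a b hab hb E hE
    refine erase_insert fun hmem => ?_
    have := (mem_gapSets.1 hE).1 _ hmem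
    omega
  rw [hS, card_biUnion, sum_filter]
  · refine sum_congr rfl fun ab hab => ?_
    split_ifs with h
    · rw [mul_one, card_image_of_injOn]
      intro E hE E' hE' heq
      have := congrArg (fun D => D.erase (f + d)) heq
      beta_reduce at this
      rwa [herase (HasAntidiagonal.mem_antidiagonal.1 hab) h.1 hE, herase (HasAntidiagonal.mem_antidiagonal.1 hab) h.1 hE'] at this
    · rw [mul_zero]
  · rintro ⟨a, b⟩ hab ⟨a', b'⟩ hab' hne
    simp only [mem_coe, mem_filter, HasAntidiagonal.mem_antidiagonal] at hab hab'
    rw [Function.onFun, disjoint_left]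
    intro D hD hD'
    obtain ⟨E, hE, rfl⟩ := mem_image.1 hD
    obtain ⟨E', hE', heq⟩ := mem_image.1 hD'
    have := congrArg (fun D => D.erase (f + d)) heq
    beta_reduce at this
    rw [herase hab.1 hab.2.1 hE, herase hab'.1 hab'.2.1 hE'] at this
    subst this
    have h1 := (mem_gapSets.1 hE).1 _ (mem_gapSets.1 hE').2.2.1
    have h2 := (mem_gapSets.1 hE').1 _ (mem_gapSets.1 hE).2.2.1
    refine hne ?_
    rw [Prod.mk.injEq]
    omega

theorem card_gapSets (w f k d : ℕ) :
    (gapSets w f k d).card = PowerSeries.coeff d (PowerSeries.gapSeries w ^ k) := by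
  induction k generalizing d with
  | zero => rw [card_gapSets_zero, pow_zero, PowerSeries.coeff_one]
  | succ k ih =>
    rw [card_gapSets_succ, pow_succ, PowerSeries.coeff_mul]
    simp only [ih, PowerSeries.gapSeries, PowerSeries.coeff_mk]

/-- Counting sets in `{0, …, m}` with gaps at most `w` and a boundary condition `Q` on the number
of points to the left of the minimum and to the right of the maximum. -/
theorem card_biUnion_gapSets (Q : ℕ → ℕ → Prop) [∀ f e, Decidable (Q f e)] (w k m : ℕ) :
    (((antidiagonal m).sigma fun ad => (antidiagonal ad.1).filter fun fe => Q fe.1 fe.2).biUnion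
      fun i => gapSets w i.2.1 k i.1.2).card =
    PowerSeries.coeff m ((PowerSeries.mk fun a =>
      ((antidiagonal a).filter fun fe => Q fe.1 fe.2).card) * PowerSeries.gapSeries w ^ k) := by
  rw [card_biUnion, sum_sigma, PowerSeries.coeff_mul]
  · refine sum_congr rfl fun ad _ => ?_
    simp only [card_gapSets, sum_const, smul_eq_mul, PowerSeries.coeff_mk]
  · rintro ⟨⟨a, d⟩, ⟨f, e⟩⟩ h ⟨⟨a', d'⟩, ⟨f', e'⟩⟩ h' hne
    simp only [mem_coe, mem_sigma, mem_filter, HasAntidiagonal.mem_antidiagonal] at h h'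
    rw [Function.onFun, disjoint_left]
    intro D hD hD'
    obtain ⟨hb, hf, hs, -, -⟩ := mem_gapSets.1 hD
    obtain ⟨hb', hf', hs', -, -⟩ := mem_gapSets.1 hD'
    dsimp only at *
    have h1 := hb _ hf'
    have h2 := hb _ hs'
    have h3 := hb' _ hf
    have h4 := hb' _ hs
    obtain rfl : f = f' := by omega
    obtain rfl : d = d' := by omega
    obtain rfl : a = a' := by omega
    obtain rfl : e = e' := by omega
    exact hne rfl

/-! ### Domination sequences as coefficients -/

namespace SimpleGraph

theorem dominationSeq_eq_zero_of_lt {V : Type*} [Fintype V] (G : SimpleGraph V) {k : ℕ}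
    (hk : Fintype.card V < k) : G.dominationSeq k = 0 := by
  classical
  rw [dominationSeq, card_eq_zero, filter_eq_empty_iff]
  rintro D - ⟨h, -⟩
  have := D.card_le_univ
  omega

theorem dominationSeq_zero {V : Type*} [Fintype V] [Nonempty V] (G : SimpleGraph V) :
    G.dominationSeq 0 = 0 := by
  classical
  rw [dominationSeq, card_eq_zero, filter_eq_empty_iff]
  rintro D - ⟨h, hD⟩
  rw [card_eq_zero] at h
  simpa [h] using hD (Classical.arbitrary V)

theorem isUnimodal_dominationSeq_of_isEmpty {V : Type*} [Fintype V] [IsEmpty V]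
    (G : SimpleGraph V) : IsUnimodal G.dominationSeq :=
  ⟨0, by simp, fun k _ => by
    rw [G.dominationSeq_eq_zero_of_lt (by simp)]
    exact Nat.zero_le _⟩

theorem isDominatingSet_power_iff {V : Type*} (G : SimpleGraph V) (ℓ : ℕ) (D : Finset V) :
    (G.power ℓ).IsDominatingSet D ↔ ∀ v, ∃ u ∈ D, G.edist v u ≤ (ℓ : ℕ∞) := by
  refine forall_congr' fun v => ⟨?_, ?_⟩
  · rintro (h | ⟨u, hu, -, h⟩)
    · exact ⟨v, h, by simp⟩
    · exact ⟨u, hu, h⟩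
  · rintro ⟨u, hu, h⟩
    by_cases hvu : v = u
    · exact .inl (hvu ▸ hu)
    · exact .inr ⟨u, hu, hvu, h⟩

/-- If domination in a graph on `Fin (m + 1)` means that gaps are at most `w` and that the boundary
condition `Q` holds, then the domination sequence is given by coefficients of power series. -/
theorem dominationSeq_succ_eq_coeff {m : ℕ} (G : SimpleGraph (Fin (m + 1))) (w : ℕ)
    (Q : ℕ → ℕ → Prop) [∀ f e, Decidable (Q f e)]
    (hG : ∀ (D : Finset (Fin (m + 1))) (f s : Fin (m + 1)), f ∈ D → s ∈ D →
      (∀ x ∈ D, f ≤ x ∧ x ≤ s) → (G.IsDominatingSet D ↔ Q f (m - s) ∧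
        ∀ x : ℕ, (f : ℕ) ≤ x → x < s → ∃ y ∈ D, x < (y : ℕ) ∧ (y : ℕ) ≤ x + w)) (k : ℕ) :
    G.dominationSeq (k + 1) = PowerSeries.coeff m ((PowerSeries.mk fun a =>
      ((antidiagonal a).filter fun fe => Q fe.1 fe.2).card) * PowerSeries.gapSeries w ^ k) := by
  classical
  rw [← card_biUnion_gapSets, dominationSeq]
  refine card_bij (fun D _ => D.map Fin.valEmbedding) ?_ ?_ ?_
  · intro D hD
    simp only [mem_filter, mem_univ, true_and] at hD
    have hne : D.Nonempty := card_pos.1 (by omega)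
    have hb : ∀ x ∈ D, D.min' hne ≤ x ∧ x ≤ D.max' hne := fun x hx =>
      ⟨min'_le _ x hx, le_max' _ x hx⟩
    have hf := min'_mem D hne
    have hs := max'_mem D hne
    obtain ⟨hQ, hg⟩ := (hG D _ _ hf hs hb).1 hD.2
    generalize D.min' hne = f at *
    generalize D.max' hne = s at *
    have hfs : (f : ℕ) ≤ s := (hb f hf).2
    have hsm := s.is_lt
    -- The length `m` splits into the two ends taken together and the span `s - f`.
    refine mem_biUnion.2 ⟨⟨(f + (m - s), s - f), (f, m - s)⟩, ?_, mem_gapSets.2 ?_⟩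
    · simp only [mem_sigma, mem_filter, HasAntidiagonal.mem_antidiagonal]
      exact ⟨by omega, trivial, hQ⟩
    · dsimp only
      rw [show (f : ℕ) + (s - f) = s by omega]
      refine ⟨?_, mem_map_of_mem Fin.valEmbedding hf, mem_map_of_mem Fin.valEmbedding hs,
        by rw [card_map, hD.1], ?_⟩
      · intro x hx
        obtain ⟨y, hy, rfl⟩ := mem_map.1 hx
        exact hb y hy
      · intro x h1 h2
        obtain ⟨y, hy, h⟩ := hg x h1 h2
        exact ⟨y, mem_map_of_mem Fin.valEmbedding hy, h⟩
  · intro D _ E _ h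
    exact Finset.map_injective _ h
  · intro E hE
    obtain ⟨⟨⟨a, d⟩, ⟨f, e⟩⟩, hi, hE⟩ := mem_biUnion.1 hE
    simp only [mem_sigma, mem_filter, HasAntidiagonal.mem_antidiagonal] at hi
    obtain ⟨hb, hf, hs, hc, hg⟩ := mem_gapSets.1 hE
    dsimp only at *
    obtain ⟨D, rfl⟩ : ∃ D : Finset (Fin (m + 1)), D.map Fin.valEmbedding = E := by
      refine ⟨E.attach.map ⟨fun x => ⟨x.1, by have := hb _ x.2; omega⟩, ?_⟩, ?_⟩
      · intro x y h
        exact Subtype.ext (congrArg Fin.val h)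
      · ext x
        rw [mem_map]
        constructor
        · rintro ⟨y, hy, rfl⟩
          obtain ⟨z, -, rfl⟩ := mem_map.1 hy
          exact z.2
        · intro hx
          exact ⟨_, mem_map_of_mem _ (mem_attach E ⟨x, hx⟩), rfl⟩
    refine ⟨D, ?_, rfl⟩
    obtain ⟨f, hfD, rfl⟩ := mem_map.1 hf
    obtain ⟨s, hsD, hsd⟩ := mem_map.1 hs
    simp only [Fin.valEmbedding_apply] at *
    rw [card_map] at hc
    simp only [mem_filter, mem_univ, true_and]
    refine ⟨hc, (hG D f s hfD hsD ?_).2 ⟨?_, ?_⟩⟩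
    · intro x hx
      have := hb _ (mem_map_of_mem Fin.valEmbedding hx)
      rw [← hsd] at this
      exact this
    · rw [show m - (s : ℕ) = e by omega]
      exact hi.2.2
    · intro x h1 h2
      obtain ⟨y, hy, h⟩ := hg x h1 (by omega)
      obtain ⟨z, hz, rfl⟩ := mem_map.1 hy
      exact ⟨z, hz, h⟩

/-- The ball of radius `ℓ` about `x + ℓ + 1` meets the vertices above `x` in those up to `x + (2 * ℓ
+ 1)`; this is why `w = 2 * ℓ + 1`. If that centre exceeds `m`, then `s` is already close enough. -/
theorem isDominatingSet_pathGraph_power_iff {m : ℕ} (ℓ : ℕ) (D : Finset (Fin (m + 1)))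
    (f s : Fin (m + 1)) (hf : f ∈ D) (hs : s ∈ D) (hb : ∀ x ∈ D, f ≤ x ∧ x ≤ s) :
    ((pathGraph (m + 1)).power ℓ).IsDominatingSet D ↔ ((f : ℕ) ≤ ℓ ∧ m - (s : ℕ) ≤ ℓ) ∧
      ∀ x : ℕ, (f : ℕ) ≤ x → x < s → ∃ y ∈ D, x < (y : ℕ) ∧ (y : ℕ) ≤ x + (2 * ℓ + 1) := by
  simp only [isDominatingSet_power_iff, edist_pathGraph_le_iff]
  simp only [Fin.le_def] at hb
  have hfs := (hb f hf).2
  have hsm := s.is_lt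
  constructor
  · intro h
    refine ⟨⟨?_, ?_⟩, fun x h1 h2 => ?_⟩
    · obtain ⟨y, hy, h⟩ := h ⟨0, by omega⟩
      have := hb y hy
      dsimp only at h
      omega
    · obtain ⟨y, hy, h⟩ := h ⟨m, by omega⟩
      have := hb y hy
      dsimp only at h
      omega
    · by_cases hx : x + ℓ + 1 ≤ m
      · obtain ⟨y, hy, h⟩ := h ⟨x + ℓ + 1, by omega⟩
        dsimp only at h
        exact ⟨y, hy, by omega, by omega⟩
      · exact ⟨s, hs, h2, by omega⟩
  · rintro ⟨⟨h1, h2⟩, h⟩ v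
    have hv := v.is_lt
    by_cases hvf : (v : ℕ) ≤ f + ℓ
    · exact ⟨f, hf, by omega⟩
    · by_cases hvs : (s : ℕ) < v
      · exact ⟨s, hs, by omega⟩
      · obtain ⟨y, hy, h⟩ := h (v - ℓ - 1) (by omega) (by omega)
        exact ⟨y, hy, by omega⟩

/-- The gap from `s` around to `f` is `f + (m - s) + 1`, and must also be at most `2 * ℓ + 1`. -/
theorem isDominatingSet_cycleGraph_power_iff {m : ℕ} (ℓ : ℕ) (D : Finset (Fin (m + 1)))
    (f s : Fin (m + 1)) (hf : f ∈ D) (hs : s ∈ D) (hb : ∀ x ∈ D, f ≤ x ∧ x ≤ s) :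
    ((cycleGraph (m + 1)).power ℓ).IsDominatingSet D ↔ (f : ℕ) + (m - (s : ℕ)) ≤ 2 * ℓ ∧
      ∀ x : ℕ, (f : ℕ) ≤ x → x < s → ∃ y ∈ D, x < (y : ℕ) ∧ (y : ℕ) ≤ x + (2 * ℓ + 1) := by
  simp only [isDominatingSet_power_iff, edist_cycleGraph_le_iff]
  simp only [Fin.le_def] at hb
  have hfs := (hb f hf).2
  have hsm := s.is_lt
  constructor
  · intro h
    refine ⟨?_, fun x h1 h2 => ?_⟩
    -- If the wrapping gap is too long, the vertex `s + ℓ + 1`, reduced modulo `m + 1`, is not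
    -- dominated.
    · by_contra hcon
      by_cases hx : s + ℓ + 1 ≤ m
      · obtain ⟨y, hy, h⟩ := h ⟨s + ℓ + 1, by omega⟩
        have := hb y hy
        dsimp only at h
        omega
      · obtain ⟨y, hy, h⟩ := h ⟨s + ℓ + 1 - (m + 1), by omega⟩
        have := hb y hy
        dsimp only at h
        omega
    · by_cases hx : x + ℓ + 1 ≤ m
      · obtain ⟨y, hy, h⟩ := h ⟨x + ℓ + 1, by omega⟩
        have := y.is_lt
        dsimp only at h
        by_cases hy1 : x < (y : ℕ)
        · exact ⟨y, hy, hy1, by omega⟩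
        -- Here `y` dominates only by wrapping around, which forces `m ≤ x + 2 * ℓ`, so `s` is
        -- within reach.
        · exact ⟨s, hs, h2, by omega⟩
      · exact ⟨s, hs, h2, by omega⟩
  · rintro ⟨h1, h⟩ v
    have hv := v.is_lt
    by_cases hvf : (v : ℕ) ≤ f + ℓ ∧ (f : ℕ) ≤ v + ℓ ∨ (v : ℕ) + ℓ ≥ f + (m + 1)
    · exact ⟨f, hf, by omega⟩
    · by_cases hvs : (s : ℕ) < v ∨ (v : ℕ) < f
      · exact ⟨s, hs, by omega⟩
      · obtain ⟨y, hy, h⟩ := h (v - ℓ - 1) (by omega) (by omega)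
        exact ⟨y, hy, by omega⟩

theorem isUnimodal_dominationSeq_pathGraph_power (n ℓ : ℕ) :
    IsUnimodal ((pathGraph n).power ℓ).dominationSeq := by
  rcases n with _ | m
  · exact isUnimodal_dominationSeq_of_isEmpty _
  · refine isUnimodal_of_coeff (fun k => dominationSeq_eq_zero_of_lt _) (dominationSeq_zero _)
      (dominationSeq_succ_eq_coeff _ (2 * ℓ + 1) (fun f e => f ≤ ℓ ∧ e ≤ ℓ)
        (isDominatingSet_pathGraph_power_iff ℓ)) (fun j => ?_)
      (PowerSeries.isLogConcave_gapSeries _)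
    have hR := PowerSeries.isLogConcave_indicator ℓ
    have hg : (PowerSeries.mk fun a => ((antidiagonal a).filter fun fe =>
        fe.1 ≤ ℓ ∧ fe.2 ≤ ℓ).card : PowerSeries ℕ) =
        (PowerSeries.mk fun j => if j ≤ ℓ then 1 else 0) *
          (PowerSeries.mk fun j => if j ≤ ℓ then 1 else 0) := by
      ext a
      rw [PowerSeries.coeff_mul, PowerSeries.coeff_mk, card_filter]
      refine sum_congr rfl fun fe _ => ?_
      simp only [PowerSeries.coeff_mk]
      split_ifs <;> simp_all
    rw [hg]
    -- The end series is a square, so multiplying twice by its log-concave root avoids proving the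
    -- square log-concave.
    have := ((PowerSeries.ratioLE_one_left (PowerSeries.gapSeries (2 * ℓ + 1) ^ j)).mul_right
      hR).mul_right hR
    rwa [one_mul, mul_assoc, mul_comm (PowerSeries.gapSeries _ ^ j)] at this

theorem isUnimodal_dominationSeq_cycleGraph_power (n ℓ : ℕ) :
    IsUnimodal ((cycleGraph n).power ℓ).dominationSeq := by
  rcases n with _ | m
  · exact isUnimodal_dominationSeq_of_isEmpty _
  · refine isUnimodal_of_coeff (fun k => dominationSeq_eq_zero_of_lt _) (dominationSeq_zero _)
      (dominationSeq_succ_eq_coeff _ (2 * ℓ + 1) (fun f e => f + e ≤ 2 * ℓ)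
        (isDominatingSet_cycleGraph_power_iff ℓ)) ?_
      (PowerSeries.isLogConcave_gapSeries _)
    have hg : (PowerSeries.mk fun a => ((antidiagonal a).filter fun fe =>
        fe.1 + fe.2 ≤ 2 * ℓ).card : PowerSeries ℕ) =
        (PowerSeries.mk fun j => if j ≤ 2 * ℓ then j + 1 else 0) := by
      ext a
      simp only [PowerSeries.coeff_mk]
      rw [filter_congr (q := fun _ => a ≤ 2 * ℓ)
        (fun fe h => by rw [HasAntidiagonal.mem_antidiagonal.1 h])]
      split_ifs with h <;> simp [h]
    rw [hg]
    exact fun j => (PowerSeries.isLogConcave_ramp _).ratioLE_mul _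

end SimpleGraph

theorem theorem3 (n ℓ : ℕ) (hℓ : 1 ≤ ℓ) :
    IsUnimodal ((SimpleGraph.pathGraph n).power ℓ).dominationSeq ∧
      IsUnimodal ((SimpleGraph.cycleGraph n).power ℓ).dominationSeq :=
  ⟨SimpleGraph.isUnimodal_dominationSeq_pathGraph_power n ℓ,
    SimpleGraph.isUnimodal_dominationSeq_cycleGraph_power n ℓ⟩
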